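/- Let $k$ be a field, and let $A$ and $B$ be finite-dimensional Hopf algebras over $k$ such that $A$ is semisimple as an algebra and $B$ is cosemisimple as a coalgebra (that is, $B$ is the sum of its simple subcoalgebras). Let $\mathbf{Hopf}(A,B)$ be the covariant functor from commutative $k$-algebras to sets that sends $L$ to the set of $L$-Hopf algebra maps $A\otimes_k L\to B\otimes_k L$, and sends an algebra map $f\colon L_1\to L_2$ to the map $\varphi\mapsto f_*\varphi$, where $(f_*\varphi)(a\otimes y)=\sum_i b_i\otimes f(x_i)y$ if $\varphi(a\otimes 1)=\sum_i b_i\otimes x_i$. Then $\mathbf{Hopf}(A,B)$ is a finite étale affine scheme over $k$. That is, it is represented by a commutative $k$-algebra, and every commutative $k$-algebra $Z$ representing it is finite-dimensional over $k$ and separable (for every field extension $E/k$ the ring $E\otimes_k Z$ is semisimple); in particular $Z$ is étale over $k$. -/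

import Mathlib

open scoped TensorProduct

universe t u v w

namespace HopfScheme

/-! ### Cosemisimple coalgebras -/

section Cosemisimple

variable {k : Type u} {C : Type v} [Field k] [AddCommGroup C] [Module k C] [Coalgebra k C]

/-- A subspace `D` of a coalgebra `C` is a subcoalgebra if `Δ(D) ⊆ D ⊗ D`, where `D ⊗ D` is
regarded as a subspace of `C ⊗ C`. -/
def IsSubcoalgebra (D : Submodule k C) : Prop :=
  ∀ x ∈ D, (Coalgebra.comul (R := k) x : C ⊗[k] C) ∈
    LinearMap.range (TensorProduct.map D.subtype D.subtype)

/-- A subcoalgebra is simple if it is nonzero and its only subcoalgebras are zero and itself. -/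
def IsSimpleSubcoalgebra (D : Submodule k C) : Prop :=
  IsSubcoalgebra D ∧ D ≠ ⊥ ∧
    ∀ E : Submodule k C, IsSubcoalgebra E → E ≤ D → E = ⊥ ∨ E = D

variable (k C) in
/-- A coalgebra is cosemisimple if it is the sum of its simple subcoalgebras, i.e. if it equals
its coradical (the sum of the simple subcoalgebras is automatically direct). -/
def IsCosemisimple : Prop :=
  sSup {D : Submodule k C | IsSimpleSubcoalgebra D} = ⊤

end Cosemisimple

/-! ### Separable algebras -/

/-- An algebra `Z` over a field `k` is separable if `E ⊗ Z` is a semisimple ring for every field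
extension `E / k`. -/
def IsSeparableAlgebra (k : Type u) (Z : Type v) [Field k] [Ring Z] [Algebra k Z] : Prop :=
  ∀ (E : Type u) [Field E] [Algebra k E], IsSemisimpleRing (E ⊗[k] Z)

/-! ### Hopf algebra maps -/

/-- Hopf algebra maps over a commutative ring `L`: the `L`-algebra maps that are `L`-coalgebra maps
and commute with the antipodes. -/
structure HopfAlgHom (L : Type t) (H : Type v) (K : Type w) [CommRing L] [Ring H] [Ring K]
    [HopfAlgebra L H] [HopfAlgebra L K] extends BialgHom L H K where
  map_antipode : ∀ x : H, toFun (HopfAlgebra.antipode L x) = HopfAlgebra.antipode L (toFun x)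

theorem HopfAlgHom.toBialgHom_injective {L : Type t} {H : Type v} {K : Type w} [CommRing L]
    [Ring H] [Ring K] [HopfAlgebra L H] [HopfAlgebra L K] {f g : HopfAlgHom L H K}
    (h : f.toBialgHom = g.toBialgHom) : f = g := by
  cases f; cases g; cases h; rfl

/-! ### Base change of Hopf algebra maps along an algebra map `f : L₁ → L₂` -/

section BaseChange

variable {k : Type u} [Field k]
variable {L₁ L₂ L₃ : Type t} [CommRing L₁] [CommRing L₂] [CommRing L₃]
  [Algebra k L₁] [Algebra k L₂] [Algebra k L₃]
variable {A : Type v} {B : Type w} [Ring A] [Ring B] [HopfAlgebra k A] [HopfAlgebra k B]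

/-- The algebra map `f ⊗ id : L₁ ⊗ A → L₂ ⊗ A`. -/
noncomputable def scalarMap (A : Type v) [Ring A] [HopfAlgebra k A] (f : L₁ →ₐ[k] L₂) :
    L₁ ⊗[k] A →ₐ[k] L₂ ⊗[k] A :=
  Algebra.TensorProduct.map f (AlgHom.id k A)

@[simp] theorem scalarMap_tmul (f : L₁ →ₐ[k] L₂) (x : L₁) (a : A) :
    scalarMap A f (x ⊗ₜ a) = f x ⊗ₜ a := rfl

theorem scalarMap_smul (f : L₁ →ₐ[k] L₂) (x : L₁) (z : L₁ ⊗[k] A) :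
    scalarMap A f (x • z) = f x • scalarMap A f z := by
  induction z with
  | zero => simp
  | add y z hy hz => simp only [smul_add, map_add, hy, hz]
  | tmul y a => simp [TensorProduct.smul_tmul']

/-- The `L₂`-algebra map `L₂ ⊗ A → L₂ ⊗ B`, `y ⊗ a ↦ y • (f ⊗ id) (φ (1 ⊗ a))`, attached to an
`L₁`-algebra map `φ : L₁ ⊗ A → L₁ ⊗ B`. -/
noncomputable def baseChangeAlgHom (f : L₁ →ₐ[k] L₂) (φ : L₁ ⊗[k] A →ₐ[L₁] L₁ ⊗[k] B) :
    L₂ ⊗[k] A →ₐ[L₂] L₂ ⊗[k] B :=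
  Algebra.TensorProduct.lift (Algebra.ofId L₂ (L₂ ⊗[k] B))
    (((scalarMap B f).comp (φ.restrictScalars k)).comp Algebra.TensorProduct.includeRight)
    (fun y _ => Algebra.commutes y _)

theorem baseChangeAlgHom_tmul (f : L₁ →ₐ[k] L₂) (φ : L₁ ⊗[k] A →ₐ[L₁] L₁ ⊗[k] B)
    (y : L₂) (a : A) :
    baseChangeAlgHom f φ (y ⊗ₜ a) = y • scalarMap B f (φ (1 ⊗ₜ a)) := by
  rw [Algebra.smul_def]
  exact Algebra.TensorProduct.lift_tmul _ _ _ y a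

theorem baseChangeAlgHom_scalarMap (f : L₁ →ₐ[k] L₂) (φ : L₁ ⊗[k] A →ₐ[L₁] L₁ ⊗[k] B)
    (z : L₁ ⊗[k] A) :
    baseChangeAlgHom f φ (scalarMap A f z) = scalarMap B f (φ z) := by
  induction z with
  | zero => simp
  | add y z hy hz => simp only [map_add, hy, hz]
  | tmul x a =>
    rw [scalarMap_tmul, baseChangeAlgHom_tmul, ← scalarMap_smul, ← map_smul,
      TensorProduct.smul_tmul', smul_eq_mul, mul_one]

/-- The additive map `(L₁ ⊗ A) ⊗ (L₁ ⊗ A) → (L₂ ⊗ A) ⊗ (L₂ ⊗ A)` induced by `f ⊗ id` on both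
factors. -/
noncomputable def scalarMap₂ (A : Type v) [Ring A] [HopfAlgebra k A] (f : L₁ →ₐ[k] L₂) :
    (L₁ ⊗[k] A) ⊗[L₁] (L₁ ⊗[k] A) →+ (L₂ ⊗[k] A) ⊗[L₂] (L₂ ⊗[k] A) :=
  TensorProduct.liftAddHom
    (AddMonoidHom.mk' (fun x => AddMonoidHom.mk'
        (fun y => scalarMap A f x ⊗ₜ[L₂] scalarMap A f y)
        (fun y z => by rw [map_add, TensorProduct.tmul_add]))
      (fun x y => by ext z; simp [TensorProduct.add_tmul]))
    (fun r x y => by simp [scalarMap_smul, TensorProduct.smul_tmul])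

@[simp] theorem scalarMap₂_tmul (f : L₁ →ₐ[k] L₂) (x y : L₁ ⊗[k] A) :
    scalarMap₂ A f (x ⊗ₜ y) = scalarMap A f x ⊗ₜ scalarMap A f y := rfl

theorem comul_one_tmul (f : L₁ →ₐ[k] L₂) (a : A) :
    (Coalgebra.comul (R := L₂) ((1 : L₂) ⊗ₜ[k] a)) =
      scalarMap₂ A f (Coalgebra.comul (R := L₁) ((1 : L₁) ⊗ₜ[k] a)) := by
  simp only [TensorProduct.comul_tmul, CommSemiring.comul_apply]
  generalize (Coalgebra.comul (R := k) a) = d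
  induction d with
  | zero => simp
  | add y z hy hz => simp only [TensorProduct.tmul_add, map_add, hy, hz]
  | tmul x y => simp

theorem scalarMap₂_smul (f : L₁ →ₐ[k] L₂) (x : L₁) (z : (L₁ ⊗[k] A) ⊗[L₁] (L₁ ⊗[k] A)) :
    scalarMap₂ A f (x • z) = f x • scalarMap₂ A f z := by
  induction z with
  | zero => simp
  | add y z hy hz => simp only [smul_add, map_add, hy, hz]
  | tmul y a => simp [TensorProduct.smul_tmul', scalarMap_smul]

theorem tmul_eq_smul (y : L₁) (a : A) : (y ⊗ₜ[k] a : L₁ ⊗[k] A) = y • (1 ⊗ₜ[k] a) := by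
  rw [TensorProduct.smul_tmul', smul_eq_mul, mul_one]

theorem comul_scalarMap (f : L₁ →ₐ[k] L₂) (z : L₁ ⊗[k] A) :
    Coalgebra.comul (R := L₂) (scalarMap A f z) =
      scalarMap₂ A f (Coalgebra.comul (R := L₁) z) := by
  induction z with
  | zero => simp
  | add y z hy hz => simp only [map_add, hy, hz]
  | tmul y a =>
    rw [scalarMap_tmul, tmul_eq_smul, tmul_eq_smul y, map_smul, map_smul, scalarMap₂_smul,
      comul_one_tmul f a]

theorem counit_scalarMap (f : L₁ →ₐ[k] L₂) (z : L₁ ⊗[k] A) :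
    Coalgebra.counit (R := L₂) (scalarMap A f z) = f (Coalgebra.counit (R := L₁) z) := by
  induction z with
  | zero => simp
  | add y z hy hz => simp only [map_add, hy, hz]
  | tmul y a => simp

theorem antipode_scalarMap (f : L₁ →ₐ[k] L₂) (z : L₁ ⊗[k] A) :
    HopfAlgebra.antipode L₂ (scalarMap A f z) =
      scalarMap A f (HopfAlgebra.antipode L₁ z) := by
  induction z with
  | zero => simp
  | add y z hy hz => simp only [map_add, hy, hz]
  | tmul y a => simp

theorem map_baseChangeAlgHom (f : L₁ →ₐ[k] L₂) (φ : L₁ ⊗[k] A →ₐ[L₁] L₁ ⊗[k] B)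
    (z : (L₁ ⊗[k] A) ⊗[L₁] (L₁ ⊗[k] A)) :
    Algebra.TensorProduct.map (baseChangeAlgHom f φ) (baseChangeAlgHom f φ) (scalarMap₂ A f z) =
      scalarMap₂ B f (Algebra.TensorProduct.map φ φ z) := by
  induction z with
  | zero => simp
  | add y z hy hz => simp only [map_add, hy, hz]
  | tmul x y => simp [baseChangeAlgHom_scalarMap]

/-- Two `L₂`-linear maps on `L₂ ⊗ A` agree if they agree on the image of `f ⊗ id`. -/
theorem linearMap_ext_scalarMap {M : Type*} [AddCommGroup M] [Module L₂ M] (f : L₁ →ₐ[k] L₂)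
    {g h : L₂ ⊗[k] A →ₗ[L₂] M}
    (H : ∀ z : L₁ ⊗[k] A, g (scalarMap A f z) = h (scalarMap A f z)) : g = h := by
  refine LinearMap.ext fun z => ?_
  induction z with
  | zero => simp
  | add y z hy hz => simp only [map_add, hy, hz]
  | tmul y a =>
    have := H (1 ⊗ₜ a)
    rw [scalarMap_tmul, map_one] at this
    rw [tmul_eq_smul, map_smul, map_smul, this]

theorem baseChangeAlgHom_antipode (f : L₁ →ₐ[k] L₂) (φ : L₁ ⊗[k] A →ₐ[L₁] L₁ ⊗[k] B)
    (hφ : ∀ z, φ (HopfAlgebra.antipode L₁ z) = HopfAlgebra.antipode L₁ (φ z)) (x : L₂ ⊗[k] A) :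
    baseChangeAlgHom f φ (HopfAlgebra.antipode L₂ x) =
      HopfAlgebra.antipode L₂ (baseChangeAlgHom f φ x) := by
  have h : (baseChangeAlgHom f φ).toLinearMap ∘ₗ HopfAlgebra.antipode L₂ =
      HopfAlgebra.antipode L₂ ∘ₗ (baseChangeAlgHom f φ).toLinearMap := by
    refine linearMap_ext_scalarMap f fun z => ?_
    simp only [LinearMap.comp_apply, AlgHom.toLinearMap_apply, antipode_scalarMap,
      baseChangeAlgHom_scalarMap, hφ]
  exact LinearMap.congr_fun h x

/-- The base change `f_* φ` of a Hopf algebra map `φ` along `f`; it is determined by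
`(f_* φ) (y ⊗ a) = ∑ᵢ f (xᵢ) y ⊗ bᵢ` if `φ (1 ⊗ a) = ∑ᵢ xᵢ ⊗ bᵢ`. -/
noncomputable def HopfAlgHom.baseChange (f : L₁ →ₐ[k] L₂)
    (φ : HopfAlgHom L₁ (L₁ ⊗[k] A) (L₁ ⊗[k] B)) : HopfAlgHom L₂ (L₂ ⊗[k] A) (L₂ ⊗[k] B) where
  toBialgHom := BialgHom.ofAlgHom (baseChangeAlgHom f (φ.toBialgHom : _ →ₐ[L₁] _))
    (by
      refine AlgHom.toLinearMap_injective (linearMap_ext_scalarMap f fun z => ?_)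
      simp only [AlgHom.toLinearMap_apply, AlgHom.comp_apply, Bialgebra.counitAlgHom_apply,
        baseChangeAlgHom_scalarMap, counit_scalarMap]
      exact congrArg f (CoalgHomClass.counit_comp_apply φ.toBialgHom z))
    (by
      refine AlgHom.toLinearMap_injective (linearMap_ext_scalarMap f fun z => ?_)
      simp only [AlgHom.toLinearMap_apply, AlgHom.comp_apply, Bialgebra.comulAlgHom_apply,
        baseChangeAlgHom_scalarMap, comul_scalarMap, map_baseChangeAlgHom]
      exact congrArg (scalarMap₂ B f)
        (DFunLike.congr_fun (BialgHom.map_comp_comulAlgHom (R := L₁) φ.toBialgHom) z))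
  map_antipode := baseChangeAlgHom_antipode f _ φ.map_antipode

theorem HopfAlgHom.baseChange_tmul (f : L₁ →ₐ[k] L₂)
    (φ : HopfAlgHom L₁ (L₁ ⊗[k] A) (L₁ ⊗[k] B)) (y : L₂) (a : A) :
    (φ.baseChange f).toBialgHom (y ⊗ₜ a) = y • scalarMap B f (φ.toBialgHom (1 ⊗ₜ a)) :=
  baseChangeAlgHom_tmul f _ y a

theorem HopfAlgHom.ext_tmul {φ ψ : HopfAlgHom L₁ (L₁ ⊗[k] A) (L₁ ⊗[k] B)}
    (h : ∀ a : A, φ.toBialgHom (1 ⊗ₜ a) = ψ.toBialgHom (1 ⊗ₜ a)) : φ = ψ := by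
  refine HopfAlgHom.toBialgHom_injective (DFunLike.ext _ _ fun z => ?_)
  induction z with
  | zero => simp
  | add y z hy hz => simp only [map_add, hy, hz]
  | tmul y a => rw [tmul_eq_smul, map_smul, map_smul, h]

theorem HopfAlgHom.baseChange_id (φ : HopfAlgHom L₁ (L₁ ⊗[k] A) (L₁ ⊗[k] B)) :
    φ.baseChange (AlgHom.id k L₁) = φ := by
  refine HopfAlgHom.ext_tmul fun a => ?_
  rw [HopfAlgHom.baseChange_tmul, one_smul, scalarMap, Algebra.TensorProduct.map_id,
    AlgHom.id_apply]

theorem HopfAlgHom.baseChange_comp (f : L₁ →ₐ[k] L₂) (g : L₂ →ₐ[k] L₃)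
    (φ : HopfAlgHom L₁ (L₁ ⊗[k] A) (L₁ ⊗[k] B)) :
    φ.baseChange (g.comp f) = (φ.baseChange f).baseChange g := by
  refine HopfAlgHom.ext_tmul fun a => ?_
  simp only [HopfAlgHom.baseChange_tmul, one_smul]
  generalize φ.toBialgHom (1 ⊗ₜ a) = z
  induction z with
  | zero => simp
  | add y z hy hz => simp only [map_add, hy, hz]
  | tmul y a => simp

end BaseChange

open CategoryTheory in
/-- The functor `L ↦ Hopf_L(L ⊗ A, L ⊗ B)`, `f ↦ f_*`, from commutative `k`-algebras to sets. -/
noncomputable def hopfFunctor (k : Type u) [Field k] (A : Type v) (B : Type w) [Ring A] [Ring B]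
    [HopfAlgebra k A] [HopfAlgebra k B] : CommAlgCat.{t} k ⥤ Type (max t v w) where
  obj L := HopfAlgHom L (L ⊗[k] A) (L ⊗[k] B)
  map f := TypeCat.ofHom fun φ => φ.baseChange f.hom
  map_id L := by ext φ; exact φ.baseChange_id
  map_comp f g := by ext φ; exact φ.baseChange_comp f.hom g.hom

end HopfScheme

/-! Representability is a matter of coordinates: the matrix entries of a Hopf map are a point of
affine space, and the quotient of the polynomial ring by the polynomials vanishing at all such
points carries a universal Hopf map (`exists_universal_hopfAlgHom`). Over a field, finite type and
formally unramified together give finite, étale and separable. What remains is rigidity: Hopf maps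
φ, ψ over L that agree modulo a square-zero ideal are equal (`HopfAlgHom.baseChange_mk_injective`).

Their difference d is a derivation and a coderivation along φ, and `biderivation_eq_zero` shows d =
0. Semisimplicity of A gives a two-sided integral Λ with ε(Λ) = 1, cosemisimplicity of B a two-sided
cointegral l with l(1) = 1; both survive base change to L. Put D(a) = ∑ S(φ a₁) d(a₂) and f = l ∘ D.
The cointegral makes d inner, d(a) = ∑ f(a₂) φ(a₁) - ∑ f(a₁) φ(a₂), so d and D take values in φ(A).
There l is invariant under the right adjoint action, because l(φ Λ) is a unit
(`isUnit_apply_integral`, a trace argument that does not need S² = id). The product rule for D then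
reads f(ab) = ε(a) f(b) + ε(b) f(a); taking a = Λ gives f = 0, hence d = 0. -/

namespace HopfScheme

/-! ### Convolution identities and integrals. -/

section Convolution

open Coalgebra HopfAlgebra WithConv

variable {L : Type*} [CommRing L] {A B : Type*} [Ring A] [Ring B] [HopfAlgebra L A]
  [HopfAlgebra L B]

variable (L A) in
/-- The first coprojection `a ↦ a ⊗ 1` as a linear map. -/
noncomputable def inlTensor : A →ₗ[L] A ⊗[L] A :=
  (Algebra.TensorProduct.includeLeft : A →ₐ[L] A ⊗[L] A).toLinearMap

variable (L A) in
/-- The second coprojection `a ↦ 1 ⊗ a` as a linear map. -/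
noncomputable def inrTensor : A →ₗ[L] A ⊗[L] A :=
  (Algebra.TensorProduct.includeRight : A →ₐ[L] A ⊗[L] A).toLinearMap

@[simp] theorem inlTensor_apply (a : A) : inlTensor L A a = a ⊗ₜ 1 := rfl

@[simp] theorem inrTensor_apply (a : A) : inrTensor L A a = 1 ⊗ₜ a := rfl

variable {C : Type*} [AddCommGroup C] [Module L C] [Coalgebra L C]

theorem inlTensor_comp_mul (f g : C →ₗ[L] A) :
    toConv (inlTensor L A ∘ₗ (toConv f * toConv g).ofConv) =
      toConv (inlTensor L A ∘ₗ f) * toConv (inlTensor L A ∘ₗ g) :=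
  congrArg toConv (LinearMap.algHom_comp_convMul_distrib _ _ _)

theorem inrTensor_comp_mul (f g : C →ₗ[L] A) :
    toConv (inrTensor L A ∘ₗ (toConv f * toConv g).ofConv) =
      toConv (inrTensor L A ∘ₗ f) * toConv (inrTensor L A ∘ₗ g) :=
  congrArg toConv (LinearMap.algHom_comp_convMul_distrib _ _ _)

theorem algHom_comp_one {D : Type*} [Ring D] [Algebra L D] (h : A →ₐ[L] D) :
    toConv (h.toLinearMap ∘ₗ (1 : WithConv (C →ₗ[L] A)).ofConv) = 1 := by
  ext c; simp [LinearMap.convOne_def]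

theorem inlTensor_mul_inrTensor :
    toConv (inlTensor L A) * toConv (inrTensor L A) = toConv (comul (R := L) (A := A)) := by
  ext a
  rw [(ℛ L a).convMul_apply]
  simpa using (ℛ L a).eq

theorem antipode_mul_inlTensor :
    toConv (inlTensor L A ∘ₗ antipode L) * toConv (inlTensor L A) = 1 := by
  have := inlTensor_comp_mul (L := L) (A := A) (antipode L) LinearMap.id
  rw [LinearMap.antipode_mul_id] at this
  exact this.symm.trans (algHom_comp_one _)

theorem inrTensor_mul_antipode :
    toConv (inrTensor L A) * toConv (inrTensor L A ∘ₗ antipode L) = 1 := by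
  have := inrTensor_comp_mul (L := L) (A := A) LinearMap.id (antipode L)
  rw [LinearMap.id_mul_antipode] at this
  exact this.symm.trans (algHom_comp_one _)

/-- `∑ Δ(a₁) (1 ⊗ S a₂) = a ⊗ 1`. -/
theorem comul_mul_inrTensor_antipode :
    toConv (comul (R := L) (A := A)) * toConv (inrTensor L A ∘ₗ antipode L) =
      toConv (inlTensor L A) := by
  rw [← inlTensor_mul_inrTensor, mul_assoc, inrTensor_mul_antipode, mul_one]

/-- `∑ (S a₁ ⊗ 1) Δ(a₂) = 1 ⊗ a`. -/
theorem inlTensor_antipode_mul_comul :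
    toConv (inlTensor L A ∘ₗ antipode L) * toConv (comul (R := L) (A := A)) =
      toConv (inrTensor L A) := by
  rw [← inlTensor_mul_inrTensor, ← mul_assoc, antipode_mul_inlTensor, one_mul]

/-- `∑ (1 ⊗ a₁) Δ(S a₂) = S a ⊗ 1`. -/
theorem inrTensor_mul_comul_antipode :
    toConv (inrTensor L A) * toConv (comul (R := L) (A := A) ∘ₗ antipode L) =
      toConv (inlTensor L A ∘ₗ antipode L) := by
  rw [← inlTensor_antipode_mul_comul, mul_assoc, LinearMap.comul_right_inv, mul_one]

/-- A two-sided integral of a Hopf algebra. -/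
structure IsTwoSidedIntegral (L : Type*) {A : Type*} [CommRing L] [Ring A] [HopfAlgebra L A]
    (Λ : A) : Prop where
  mul_left : ∀ a, a * Λ = counit (R := L) a • Λ
  mul_right : ∀ a, Λ * a = counit (R := L) a • Λ

/-- A two-sided cointegral of a Hopf algebra, i.e. a two-sided integral of the dual. -/
structure IsTwoSidedCointegral {L : Type*} {B : Type*} [CommRing L] [Ring B] [HopfAlgebra L B]
    (l : B →ₗ[L] L) : Prop where
  left : ∀ b, TensorProduct.lid L B (l.rTensor B (comul b)) = l b • 1
  right : ∀ b, TensorProduct.rid L B (l.lTensor B (comul b)) = l b • 1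

/-- Write a ⊗ 1 = ∑ Δ(a₁)(1 ⊗ S a₂); then Δ(Λ)Δ(a₁) = Δ(Λ a₁) = ε(a₁) Δ(Λ) collapses the sum. Moving
elements across Δ(Λ) this way is the only use of Λ in the exchange arguments below. -/
theorem IsTwoSidedIntegral.comul_mul_tmul_one {Λ : A} (h : IsTwoSidedIntegral L Λ) (a : A) :
    comul (R := L) Λ * (a ⊗ₜ 1) = comul (R := L) Λ * (1 ⊗ₜ antipode L a) := by
  have h1 := congrArg (fun f => comul (R := L) Λ * f a)
    (comul_mul_inrTensor_antipode (L := L) (A := A))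
  simp only [(ℛ L a).convMul_apply] at h1
  change _ = comul (R := L) Λ * (a ⊗ₜ 1) at h1
  rw [← h1, Finset.mul_sum]
  change ∑ i ∈ _, _ * (comul (R := L) _ * (inrTensor L A ∘ₗ antipode L) _) = _
  simp only [← mul_assoc, ← Bialgebra.comul_mul, h.mul_right, map_smul, smul_mul_assoc,
    LinearMap.comp_apply, inrTensor_apply]
  simp only [← mul_smul_comm, ← TensorProduct.tmul_smul, ← map_smul, ← Finset.mul_sum,
    ← TensorProduct.tmul_sum, ← map_sum, Coalgebra.sum_counit_smul]

theorem IsTwoSidedIntegral.tmul_one_mul_comul {Λ : A} (h : IsTwoSidedIntegral L Λ) (a : A) :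
    (antipode L a ⊗ₜ 1) * comul (R := L) Λ = (1 ⊗ₜ a) * comul (R := L) Λ := by
  have h1 := congrArg (fun f => f a * comul (R := L) Λ)
    (inlTensor_antipode_mul_comul (L := L) (A := A))
  simp only [(ℛ L a).convMul_apply] at h1
  change _ = (1 ⊗ₜ a) * comul (R := L) Λ at h1
  rw [← h1, Finset.sum_mul]
  change _ = ∑ i ∈ _, ((inlTensor L A ∘ₗ antipode L) _ * comul (R := L) _) * _
  simp only [mul_assoc, ← Bialgebra.comul_mul, h.mul_left, map_smul, mul_smul_comm,
    LinearMap.comp_apply, inlTensor_apply]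
  simp only [← smul_mul_assoc, TensorProduct.smul_tmul', ← map_smul, ← Finset.sum_mul,
    ← TensorProduct.sum_tmul, ← map_sum]
  rw [show ∑ x ∈ (ℛ L a).index, counit (R := L) ((ℛ L a).right x) • (ℛ L a).left x = a by
    have := congrArg (TensorProduct.rid L A) (Coalgebra.sum_tmul_counit_eq (ℛ L a))
    simpa only [map_sum, TensorProduct.rid_tmul, one_smul] using this]

end Convolution

/-! ### The form l ∘ φ and its adjoint invariance. -/

section Rigidity

open Coalgebra HopfAlgebra WithConv

variable {L : Type*} [CommRing L] {A B : Type*} [Ring A] [Ring B] [HopfAlgebra L A]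
  [HopfAlgebra L B]

/-- The map `x ⊗ y ↦ l (φ x) • φ y`. -/
noncomputable def contractLeft (φ : A →ₐ[L] B) (l : B →ₗ[L] L) : A ⊗[L] A →ₗ[L] B :=
  (TensorProduct.lid L B).toLinearMap ∘ₗ TensorProduct.map (l ∘ₗ φ.toLinearMap) φ.toLinearMap

/-- The map `x ⊗ y ↦ l (φ y) • φ x`. -/
noncomputable def contractRight (φ : A →ₐ[L] B) (l : B →ₗ[L] L) : A ⊗[L] A →ₗ[L] B :=
  (TensorProduct.rid L B).toLinearMap ∘ₗ TensorProduct.map φ.toLinearMap (l ∘ₗ φ.toLinearMap)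

@[simp] theorem contractLeft_tmul (φ : A →ₐ[L] B) (l : B →ₗ[L] L) (x y : A) :
    contractLeft φ l (x ⊗ₜ y) = l (φ x) • φ y := rfl

@[simp] theorem contractRight_tmul (φ : A →ₐ[L] B) (l : B →ₗ[L] L) (x y : A) :
    contractRight φ l (x ⊗ₜ y) = l (φ y) • φ x := rfl

theorem contractLeft_mul (φ : A →ₐ[L] B) (l : B →ₗ[L] L) (t : A ⊗[L] A) (x : A) :
    contractLeft φ l (t * (1 ⊗ₜ x)) = contractLeft φ l t * φ x := by
  induction t with
  | zero => simp
  | add y z hy hz => simp only [add_mul, map_add, hy, hz]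
  | tmul y z => simp

theorem mul_contractLeft (φ : A →ₐ[L] B) (l : B →ₗ[L] L) (t : A ⊗[L] A) (x : A) :
    contractLeft φ l ((1 ⊗ₜ x) * t) = φ x * contractLeft φ l t := by
  induction t with
  | zero => simp
  | add y z hy hz => simp only [mul_add, map_add, hy, hz]
  | tmul y z => simp

theorem contractRight_mul (φ : A →ₐ[L] B) (l : B →ₗ[L] L) (t : A ⊗[L] A) (x : A) :
    contractRight φ l (t * (x ⊗ₜ 1)) = contractRight φ l t * φ x := by
  induction t with
  | zero => simp
  | add y z hy hz => simp only [add_mul, map_add, hy, hz]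
  | tmul y z => simp

theorem mul_contractRight (φ : A →ₐ[L] B) (l : B →ₗ[L] L) (t : A ⊗[L] A) (x : A) :
    contractRight φ l ((x ⊗ₜ 1) * t) = φ x * contractRight φ l t := by
  induction t with
  | zero => simp
  | add y z hy hz => simp only [mul_add, map_add, hy, hz]
  | tmul y z => simp

theorem apply_contractLeft_eq (φ : A →ₐ[L] B) (l : B →ₗ[L] L) (t : A ⊗[L] A) :
    l (contractLeft φ l t) = l (contractRight φ l t) := by
  induction t with
  | zero => simp
  | add y z hy hz => simp only [map_add, hy, hz]
  | tmul y z => simp [mul_comm]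

variable (φ : A →ₐc[L] B) {l : B →ₗ[L] L} {Λ : A}

theorem IsTwoSidedCointegral.contractLeft_comul (hl : IsTwoSidedCointegral l) (a : A) :
    contractLeft (φ : A →ₐ[L] B) l (comul a) = l (φ a) • 1 := by
  rw [← hl.left, ← CoalgHomClass.map_comp_comul_apply, ← (ℛ L a).eq]
  simp

theorem IsTwoSidedCointegral.contractRight_comul (hl : IsTwoSidedCointegral l) (a : A) :
    contractRight (φ : A →ₐ[L] B) l (comul a) = l (φ a) • 1 := by
  rw [← hl.right, ← CoalgHomClass.map_comp_comul_apply, ← (ℛ L a).eq]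
  simp

/-- Both sides evaluate l(φ ·) ⊗ l(φ ·) on one tensor: (1 ⊗ y) Δ(Λ) (1 ⊗ S x) equals (S y ⊗ 1) Δ(Λ)
(x ⊗ 1) by the integral. Contracting the first with l on the left leg, the second on the right leg,
the cointegral turns Δ(Λ) into l(φ Λ). -/
theorem smul_apply_mul_antipode (hl : IsTwoSidedCointegral l) (hΛ : IsTwoSidedIntegral L Λ)
    (y x : A) :
    l (φ Λ) * l (φ (y * antipode L x)) = l (φ Λ) * l (φ (antipode L y * x)) := by
  have h : l (contractLeft (φ : A →ₐ[L] B) l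
      ((1 ⊗ₜ y) * comul (R := L) Λ * (1 ⊗ₜ antipode L x))) =
      l (contractRight (φ : A →ₐ[L] B) l
      ((antipode L y ⊗ₜ 1) * comul (R := L) Λ * (x ⊗ₜ 1))) := by
    rw [apply_contractLeft_eq, ← hΛ.tmul_one_mul_comul, mul_assoc, ← hΛ.comul_mul_tmul_one,
      mul_assoc]
  rw [contractLeft_mul, mul_contractLeft, contractRight_mul, mul_contractRight,
    hl.contractLeft_comul, hl.contractRight_comul] at h
  simpa using h

/-- If c were not a unit, then over the nonzero ring L/(c) the map f would square to zero, so its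
trace would be nilpotent, yet that trace is 1. -/
theorem isUnit_of_comp_self_eq_smul {M : Type*} [AddCommGroup M] [Module L M] [Module.Free L M]
    [Module.Finite L M] {f g : M →ₗ[L] M} {c : L} (h : f ∘ₗ f = c • g)
    (hf : LinearMap.trace L M f = 1) : IsUnit c := by
  by_contra hu
  have hne : Ideal.span {c} ≠ ⊤ := by rwa [Ne, Ideal.span_singleton_eq_top]
  have : Nontrivial (L ⧸ Ideal.span {c}) := Ideal.Quotient.nontrivial_iff.mpr hne
  have hnil : IsNilpotent (f.baseChange (L ⧸ Ideal.span {c})) := by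
    have h0 : (f.baseChange (L ⧸ Ideal.span {c})) ∘ₗ (f.baseChange (L ⧸ Ideal.span {c})) = 0 := by
      rw [← LinearMap.baseChange_comp, h, LinearMap.baseChange_smul]
      refine LinearMap.ext fun x => ?_
      rw [LinearMap.smul_apply, ← algebraMap_smul (L ⧸ Ideal.span {c}) c,
        Ideal.Quotient.algebraMap_eq,
        Ideal.Quotient.eq_zero_iff_mem.mpr (Ideal.mem_span_singleton_self c), zero_smul,
        LinearMap.zero_apply]
    exact ⟨2, (pow_two _).trans h0⟩
  have := LinearMap.isNilpotent_trace_of_isNilpotent hnil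
  rw [LinearMap.trace_baseChange, hf, map_one] at this
  exact not_isNilpotent_one this

theorem isUnit_apply_integral [Module.Free L A] [Module.Finite L A]
    (hS : ∀ a, φ (antipode L a) = antipode L (φ a))
    (hl : IsTwoSidedCointegral l) (hl1 : l 1 = 1)
    (hΛ : IsTwoSidedIntegral L Λ) (hΛ1 : counit (R := L) Λ = 1) : IsUnit (l (φ Λ)) := by
  set c := l (φ Λ) with hc
  -- T(y) = ∑ l(φ(Λ₁ y)) S(Λ₂), chosen so that its trace is l(φ(∑ Λ₁ S(Λ₂))) = ε(Λ) l(1) = 1.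
  obtain ⟨T, hT⟩ : ∃ T : A →ₗ[L] A, T = ∑ i ∈ (ℛ L Λ).index,
    (l ∘ₗ (φ : A →ₐ[L] B).toLinearMap ∘ₗ LinearMap.mulLeft L ((ℛ L Λ).left i)).smulRight
      (antipode L ((ℛ L Λ).right i)) := ⟨_, rfl⟩
  have hTy (y : A) : T y = ∑ i ∈ (ℛ L Λ).index,
      l (φ ((ℛ L Λ).left i * y)) • antipode L ((ℛ L Λ).right i) := by
    simp [hT, LinearMap.sum_apply]
  have htr : LinearMap.trace L A T = 1 := by
    have h := sum_mul_antipode_eq_smul (R := L) (ℛ L Λ)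
    have h' := congrArg (fun x => l (φ x)) h
    simp only [hΛ1, one_smul, map_one, hl1, map_sum] at h'
    simp only [hT, map_sum, LinearMap.trace_smulRight]
    simpa using h'
  -- Contract Δ(Λ)(y ⊗ 1) = Δ(Λ)(1 ⊗ S y) with l on the left leg and apply the antipode of B.
  have hφT (y : A) : φ (T y) = c • φ (antipode L (antipode L y)) := by
    have h := hl.contractLeft_comul φ Λ
    have h' := contractLeft_mul (φ : A →ₐ[L] B) l (comul Λ) (antipode L y)
    rw [h, ← hΛ.comul_mul_tmul_one, ← (ℛ L Λ).eq, Finset.sum_mul, map_sum] at h'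
    have h2 := congrArg (antipode L) h'
    rw [hTy]
    simpa [hS] using h2
  -- T(y) depends only on φ(y), so the formula for φ(T y) can be substituted.
  have hTT (y : A) : T (T y) = c • T (antipode L (antipode L y)) := by
    rw [hTy (T y), hTy (antipode L _), Finset.smul_sum]
    refine Finset.sum_congr rfl fun i _ => ?_
    rw [map_mul, hφT, mul_smul_comm, map_smul, ← map_mul, smul_eq_mul, mul_smul]
  exact isUnit_of_comp_self_eq_smul
    (LinearMap.ext hTT : T ∘ₗ T = c • (T ∘ₗ antipode L ∘ₗ antipode L)) htr

/-- The composite of a cointegral with a Hopf map out of a Hopf algebra with a normalized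
two-sided integral is invariant under the right adjoint action. -/
theorem sum_apply_antipode_mul_mul (hl : IsTwoSidedCointegral l) (hΛ : IsTwoSidedIntegral L Λ)
    (hu : IsUnit (l (φ Λ))) (b w : A) :
    ∑ i ∈ (ℛ L b).index, l (φ (antipode L ((ℛ L b).left i) * w * (ℛ L b).right i)) =
      counit (R := L) b * l (φ w) := by
  have h (y x : A) : l (φ (antipode L y * x)) = l (φ (y * antipode L x)) :=
    (hu.mul_left_cancel (smul_apply_mul_antipode φ hl hΛ y x)).symm
  -- Moving S across the product turns S(b₁)(w b₂) into b₁ S(b₂) S(w), which sums to ε(b) S(w); this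
  -- identity removes the last S.
  have h1 : l (φ w) = l (φ (antipode L w)) := by simpa using h 1 w
  simp only [mul_assoc, h, antipode_mul_antidistrib]
  simp only [← mul_assoc, ← map_sum, ← Finset.sum_mul, sum_mul_antipode_eq_smul]
  rw [h1, smul_mul_assoc, one_mul, map_smul, map_smul, smul_eq_mul]

end Rigidity

/-! ### Logarithmic derivatives and the vanishing of biderivations. -/

section Rigidity

open Coalgebra HopfAlgebra WithConv

variable {L : Type*} [CommRing L] {A B : Type*} [Ring A] [Ring B] [HopfAlgebra L A]
  [HopfAlgebra L B]

theorem inlTensor_comp_mul_inrTensor_comp (f g : A →ₗ[L] B) :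
    toConv (inlTensor L B ∘ₗ f) * toConv (inrTensor L B ∘ₗ g) =
      toConv (TensorProduct.map f g ∘ₗ comul) := by
  ext a
  rw [(ℛ L a).convMul_apply]
  simp [← (ℛ L a).eq]

theorem comul_comp_mul (f g : A →ₗ[L] B) :
    toConv (comul ∘ₗ (toConv f * toConv g).ofConv) =
      toConv (comul ∘ₗ f) * toConv (comul ∘ₗ g) :=
  congrArg toConv (LinearMap.algHom_comp_convMul_distrib (Bialgebra.comulAlgHom L B) _ _)

theorem inrTensor_comp_mul_comul_antipode_comp (φ : A →ₐc[L] B) :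
    toConv (inrTensor L B ∘ₗ (φ : A →ₗ[L] B)) *
        toConv (comul ∘ₗ antipode L ∘ₗ (φ : A →ₗ[L] B)) =
      toConv (inlTensor L B ∘ₗ antipode L ∘ₗ (φ : A →ₗ[L] B)) := by
  have h := LinearMap.convMul_comp_coalgHom_distrib (toConv (inrTensor L B))
    (toConv (comul ∘ₗ antipode L)) (φ : A →ₗc[L] B)
  rw [inrTensor_mul_comul_antipode] at h
  exact congrArg toConv h.symm

theorem antipode_comp_mul_self (φ : A →ₐc[L] B) :
    toConv (antipode L ∘ₗ (φ : A →ₗ[L] B)) * toConv (φ : A →ₗ[L] B) = 1 := by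
  have h := LinearMap.convMul_comp_coalgHom_distrib (toConv (antipode L))
    (toConv LinearMap.id) (φ : A →ₗc[L] B)
  rw [LinearMap.antipode_mul_id] at h
  refine (congrArg toConv h.symm).trans ?_
  ext a
  simp [LinearMap.convOne_def]

/-- The logarithmic derivative `a ↦ ∑ S(φ a₁) d(a₂)`. -/
noncomputable def logDeriv (φ : A →ₐc[L] B) (d : A →ₗ[L] B) : A →ₗ[L] B :=
  (toConv (antipode L ∘ₗ (φ : A →ₗ[L] B)) * toConv d).ofConv

theorem logDeriv_apply (φ : A →ₐc[L] B) (d : A →ₗ[L] B) {ι : Type*} {a : A} (r : Repr L a ι) :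
    logDeriv φ d a = ∑ i ∈ r.index, antipode L (φ (r.left i)) * d (r.right i) :=
  r.convMul_apply _ _

variable {φ : A →ₐc[L] B} {d : A →ₗ[L] B} {l : B →ₗ[L] L} {Λ : A}

/-- Expand Δ(D a) with the coderivation rule. The factor 1 ⊗ φ(a₁) on the left cancels one leg of
Δ(S φ(a₂)), leaving S φ ⊗ 1; this produces D in the first summand and S φ * φ = 1 in the second. -/
theorem comul_logDeriv
    (hd : comul ∘ₗ d = TensorProduct.map d (φ : A →ₗ[L] B) ∘ₗ comul +
      TensorProduct.map (φ : A →ₗ[L] B) d ∘ₗ comul) :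
    toConv (inrTensor L B ∘ₗ (φ : A →ₗ[L] B)) * toConv (comul ∘ₗ logDeriv φ d) =
      toConv (TensorProduct.map (logDeriv φ d) (φ : A →ₗ[L] B) ∘ₗ comul) +
        toConv (inrTensor L B ∘ₗ d) := by
  rw [logDeriv, comul_comp_mul, ← mul_assoc, inrTensor_comp_mul_comul_antipode_comp, hd,
    toConv_add, ← inlTensor_comp_mul_inrTensor_comp, ← inlTensor_comp_mul_inrTensor_comp,
    ← inlTensor_comp_mul_inrTensor_comp, inlTensor_comp_mul, mul_add, ← mul_assoc, ← mul_assoc,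
    ← inlTensor_comp_mul (antipode L ∘ₗ (φ : A →ₗ[L] B)) (φ : A →ₗ[L] B), antipode_comp_mul_self]
  rw [show toConv (inlTensor L B ∘ₗ (1 : WithConv (A →ₗ[L] B)).ofConv) = 1 from
    algHom_comp_one _, one_mul]

/-- A coderivation into a Hopf algebra with a normalized cointegral is inner. -/
theorem coderivation_eq (hl : IsTwoSidedCointegral l) (hl1 : l 1 = 1)
    (hd : comul ∘ₗ d = TensorProduct.map d (φ : A →ₗ[L] B) ∘ₗ comul +
      TensorProduct.map (φ : A →ₗ[L] B) d ∘ₗ comul) (a : A) :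
    d a = ∑ i ∈ (ℛ L a).index, l (logDeriv φ d ((ℛ L a).right i)) • φ ((ℛ L a).left i) -
      ∑ i ∈ (ℛ L a).index, l (logDeriv φ d ((ℛ L a).left i)) • φ ((ℛ L a).right i) := by
  -- Apply l to the first leg: the cointegral evaluates Δ(D a₂), and l(1) = 1 isolates d(a).
  have h := congrArg (fun f => contractLeft (AlgHom.id L B) l (f a)) (comul_logDeriv hd)
  simp only [(ℛ L a).convMul_apply] at h
  change contractLeft (AlgHom.id L B) l (∑ i ∈ (ℛ L a).index,
      (1 ⊗ₜ φ ((ℛ L a).left i)) * comul (R := L) (logDeriv φ d ((ℛ L a).right i))) =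
    contractLeft (AlgHom.id L B) l
      (TensorProduct.map (logDeriv φ d) (φ : A →ₗ[L] B) (comul a) + 1 ⊗ₜ d a) at h
  have hc (b : B) : contractLeft (AlgHom.id L B) l (comul b) = l b • 1 :=
    hl.contractLeft_comul (BialgHom.id L B) b
  rw [map_add, ← (ℛ L a).eq, map_sum] at h
  simp only [mul_contractLeft, hc, map_sum, TensorProduct.map_tmul, contractLeft_tmul,
    AlgHom.id_apply, hl1, one_smul, mul_smul_comm, mul_one] at h
  rw [eq_sub_iff_add_eq, add_comm]
  exact h.symm

/-- S reverses products, so S φ(a₁b₁) = S φ(b₁) S φ(a₁). In the term φ(a₂) d(b₂) the factors from a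
cancel to ε(a); in the term d(a₂) φ(b₂) they assemble to D(a), conjugated by b. -/
theorem logDeriv_mul
    (hmul : ∀ a b, d (a * b) = φ a * d b + d a * φ b) (a b : A) :
    logDeriv φ d (a * b) = counit (R := L) a • logDeriv φ d b +
      ∑ i ∈ (ℛ L b).index,
        antipode L (φ ((ℛ L b).left i)) * logDeriv φ d a * φ ((ℛ L b).right i) := by
  have h1 := LinearMap.congr_fun (congrArg ofConv (antipode_comp_mul_self φ)) a
  change (toConv (antipode L ∘ₗ (φ : A →ₗ[L] B)) * toConv (φ : A →ₗ[L] B)) a =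
    algebraMap L B (counit a) at h1
  rw [(ℛ L a).convMul_apply] at h1
  change ∑ i ∈ _, antipode L (φ _) * φ _ = _ at h1
  rw [logDeriv_apply φ d ((ℛ L a).mul (ℛ L b)), logDeriv_apply φ d (ℛ L a),
    logDeriv_apply φ d (ℛ L b)]
  have h2 (j) : antipode L (φ ((ℛ L b).left j)) *
      (∑ i ∈ (ℛ L a).index, antipode L (φ ((ℛ L a).left i)) * φ ((ℛ L a).right i)) *
      d ((ℛ L b).right j) =
      counit (R := L) a • (antipode L (φ ((ℛ L b).left j)) * d ((ℛ L b).right j)) := by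
    rw [h1, ← Algebra.commutes, mul_assoc, Algebra.smul_def]
  rw [Finset.smul_sum, ← Finset.sum_congr rfl fun j _ => h2 j, ← Finset.sum_add_distrib]
  change ∑ i ∈ (ℛ L a).index ×ˢ (ℛ L b).index,
    antipode L (φ ((ℛ L a).left i.1 * (ℛ L b).left i.2)) *
      d ((ℛ L a).right i.1 * (ℛ L b).right i.2) = _
  simp only [Finset.sum_product_right, map_mul, antipode_mul_antidistrib, hmul,
    Finset.mul_sum, Finset.sum_mul, ← Finset.sum_add_distrib, mul_add, mul_assoc]

/-- A linear map which is both a derivation and a coderivation along a Hopf map from a Hopf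
algebra with a normalized integral to one with a normalized cointegral vanishes. -/
theorem biderivation_eq_zero [Module.Free L A] [Module.Finite L A]
    (hS : ∀ a, φ (antipode L a) = antipode L (φ a))
    (hl : IsTwoSidedCointegral l) (hl1 : l 1 = 1)
    (hΛ : IsTwoSidedIntegral L Λ) (hΛ1 : counit (R := L) Λ = 1)
    (hmul : ∀ a b, d (a * b) = φ a * d b + d a * φ b)
    (hd : comul ∘ₗ d = TensorProduct.map d (φ : A →ₗ[L] B) ∘ₗ comul +
      TensorProduct.map (φ : A →ₗ[L] B) d ∘ₗ comul) : d = 0 := by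
  have hu := isUnit_apply_integral φ hS hl hl1 hΛ hΛ1
  -- Adjoint invariance is known only for l ∘ φ, so D(a) has to be lifted to A; innerness of d makes
  -- this possible.
  have hdr (a : A) : d a ∈ (φ : A →ₐ[L] B).range := by
    rw [coderivation_eq hl hl1 hd a]
    exact sub_mem
      (sum_mem fun i _ => Subalgebra.smul_mem _ (AlgHom.mem_range_self (φ : A →ₐ[L] B) _) _)
      (sum_mem fun i _ => Subalgebra.smul_mem _ (AlgHom.mem_range_self (φ : A →ₐ[L] B) _) _)
  have hr (a : A) : ∃ w, φ w = logDeriv φ d a := by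
    rw [logDeriv_apply φ d (ℛ L a)]
    change _ ∈ (φ : A →ₐ[L] B).range
    refine sum_mem fun i _ => mul_mem ?_ (hdr _)
    rw [← hS]
    exact AlgHom.mem_range_self (φ : A →ₐ[L] B) _
  have hf (a b : A) : l (logDeriv φ d (a * b)) =
      counit (R := L) a * l (logDeriv φ d b) + counit (R := L) b * l (logDeriv φ d a) := by
    obtain ⟨w, hw⟩ := hr a
    rw [logDeriv_mul hmul, ← hw, ← sum_apply_antipode_mul_mul φ hl hΛ hu, map_add, map_smul,
      map_sum, smul_eq_mul]
    simp only [map_mul, hS]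
  have hf0 (b : A) : l (logDeriv φ d b) = 0 := by
    -- Since Λb = ε(b)Λ and ε(Λ) = 1, the term ε(b) f(Λ) appears on both sides and only f(b) is
    -- left.
    have h := hf Λ b
    rw [hΛ.mul_right, map_smul, map_smul, smul_eq_mul, hΛ1, one_mul] at h
    exact right_eq_add.mp h
  refine LinearMap.ext fun a => ?_
  rw [coderivation_eq hl hl1 hd a]
  simp [hf0]

end Rigidity

/-! ### Integrals from semisimplicity, and base change. -/

section Integral

open Coalgebra

/-- Split R = ker e ⊕ J as left ideals and let x be the J-component of 1. If e(a) = e(b), then (a -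
b)x lies in both summands. -/
theorem exists_mul_eq_mul_of_isSemisimpleRing {R K : Type*} [Ring R] [IsSemisimpleRing R]
    [Field K] (e : R →+* K) : ∃ x, e x = 1 ∧ ∀ a b, e a = e b → a * x = b * x := by
  obtain ⟨J, hJ⟩ := exists_isCompl (RingHom.ker e : Submodule R R)
  obtain ⟨i, hi, x, hx, h⟩ := Submodule.mem_sup.mp
    (hJ.sup_eq_top ▸ Submodule.mem_top : (1 : R) ∈ RingHom.ker e ⊔ J)
  refine ⟨x, ?_, fun a b hab => ?_⟩
  · have := congrArg e h
    rwa [map_add, (RingHom.mem_ker).mp hi, zero_add, map_one] at this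
  · rw [← sub_eq_zero, ← sub_mul]
    refine Submodule.disjoint_def.mp hJ.disjoint _ ?_ (J.smul_mem (a - b) hx)
    exact (RingHom.mem_ker).mpr (by rw [map_mul, map_sub, hab, sub_self, zero_mul])

theorem exists_isTwoSidedIntegral (k : Type*) (A : Type*) [Field k] [Ring A] [HopfAlgebra k A]
    [IsSemisimpleRing A] : ∃ Λ : A, IsTwoSidedIntegral k Λ ∧ counit (R := k) Λ = 1 := by
  obtain ⟨x, hx, hx'⟩ :=
    exists_mul_eq_mul_of_isSemisimpleRing (Bialgebra.counitAlgHom k A).toRingHom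
  -- The opposite ring yields a right integral y. It equals the left integral x, since yx is both
  -- ε(y)x and ε(x)y.
  obtain ⟨y, hy, hy'⟩ := exists_mul_eq_mul_of_isSemisimpleRing
    ((Bialgebra.counitAlgHom k A).toRingHom.fromOpposite fun _ _ => Commute.all _ _)
  have hl (a : A) : a * x = counit (R := k) a • x := by
    rw [← one_mul x, ← smul_mul_assoc, ← mul_assoc, mul_one]
    exact hx' _ _ (by simp)
  have hr (a : A) : y.unop * a = counit (R := k) a • y.unop := by
    have := congrArg MulOpposite.unop
      (hy' (MulOpposite.op a) (MulOpposite.op (counit (R := k) a • 1)) (by simp))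
    simpa using this
  have hxy : y.unop = x := by
    have h1 := hl y.unop
    rw [hr, show counit (R := k) x = 1 from hx, show counit (R := k) y.unop = 1 from hy] at h1
    simpa using h1
  exact ⟨x, ⟨hl, hxy ▸ hr⟩, hx⟩

variable {k : Type*} [Field k] {L : Type*} [CommRing L] [Algebra k L]

theorem IsTwoSidedIntegral.one_tmul {A : Type*} [Ring A] [HopfAlgebra k A] {Λ : A}
    (h : IsTwoSidedIntegral k Λ) : IsTwoSidedIntegral L ((1 : L) ⊗ₜ[k] Λ) where
  mul_left a := by
    induction a with
    | zero => simp
    | add y z hy hz => simp only [add_mul, map_add, hy, hz, add_smul]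
    | tmul y a => simp [h.mul_left, TensorProduct.smul_tmul']
  mul_right a := by
    induction a with
    | zero => simp
    | add y z hy hz => simp only [mul_add, map_add, hy, hz, add_smul]
    | tmul y a => simp [h.mul_right, TensorProduct.smul_tmul']

variable (L) in
/-- The `L`-linear extension of a linear form. -/
noncomputable def formBaseChange {B : Type*} [AddCommGroup B] [Module k B] (l : B →ₗ[k] k) :
    L ⊗[k] B →ₗ[L] L :=
  (TensorProduct.AlgebraTensorModule.rid k L L).toLinearMap ∘ₗ l.baseChange L

@[simp] theorem formBaseChange_tmul {B : Type*} [AddCommGroup B] [Module k B] (l : B →ₗ[k] k)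
    (x : L) (b : B) : formBaseChange L l (x ⊗ₜ b) = l b • x := by
  simp [formBaseChange]

theorem IsTwoSidedCointegral.formBaseChange {B : Type*} [Ring B] [HopfAlgebra k B]
    {l : B →ₗ[k] k} (h : IsTwoSidedCointegral l) :
    IsTwoSidedCointegral (formBaseChange L l) where
  left a := by
    induction a with
    | zero => simp
    | add y z hy hz => simp only [map_add, hy, hz, add_smul]
    | tmul y a =>
      have key (d : B ⊗[k] B) : TensorProduct.lid L (L ⊗[k] B)
          ((HopfScheme.formBaseChange L l).rTensor (L ⊗[k] B)
            (TensorProduct.AlgebraTensorModule.tensorTensorTensorComm k L k L L L B B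
              ((1 ⊗ₜ y) ⊗ₜ d))) = y ⊗ₜ TensorProduct.lid k B (l.rTensor B d) := by
        induction d with
        | zero => simp
        | add u v hu hv => simp only [TensorProduct.tmul_add, map_add, hu, hv]
        | tmul u v => simp [TensorProduct.smul_tmul']
      rw [TensorProduct.comul_tmul, CommSemiring.comul_apply, key, h.left]
      simp [Algebra.TensorProduct.one_def, TensorProduct.smul_tmul']
  right a := by
    induction a with
    | zero => simp
    | add y z hy hz => simp only [map_add, hy, hz, add_smul]
    | tmul y a =>
      have key (d : B ⊗[k] B) : TensorProduct.rid L (L ⊗[k] B)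
          ((HopfScheme.formBaseChange L l).lTensor (L ⊗[k] B)
            (TensorProduct.AlgebraTensorModule.tensorTensorTensorComm k L k L L L B B
              ((1 ⊗ₜ y) ⊗ₜ d))) = y ⊗ₜ TensorProduct.rid k B (l.lTensor B d) := by
        induction d with
        | zero => simp
        | add u v hu hv => simp only [TensorProduct.tmul_add, map_add, hu, hv]
        | tmul u v => simp [TensorProduct.smul_tmul']
      rw [TensorProduct.comul_tmul, CommSemiring.comul_apply, key, h.right]
      simp [Algebra.TensorProduct.one_def, TensorProduct.smul_tmul']

end Integral

/-! ### Cointegrals from cosemisimplicity. -/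

section Cointegral

open Coalgebra

section TensorSlices

variable {k V W : Type*} [Field k] [AddCommGroup V] [Module k V] [AddCommGroup W] [Module k W]

theorem tensor_eq_zero_of_rTensor (t : V ⊗[k] W)
    (h : ∀ f : V →ₗ[k] k, TensorProduct.lid k W (f.rTensor W t) = 0) : t = 0 := by
  classical
  let b := Module.Free.chooseBasis k V
  refine (TensorProduct.equivFinsuppOfBasisLeft b).injective (Finsupp.ext fun i => ?_)
  rw [TensorProduct.equivFinsuppOfBasisLeft_apply, h, map_zero, Finsupp.zero_apply]

theorem tensor_eq_zero_of_lTensor (t : V ⊗[k] W)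
    (h : ∀ f : W →ₗ[k] k, TensorProduct.rid k V (f.lTensor V t) = 0) : t = 0 := by
  classical
  let b := Module.Free.chooseBasis k W
  refine (TensorProduct.equivFinsuppOfBasisRight b).injective (Finsupp.ext fun i => ?_)
  rw [TensorProduct.equivFinsuppOfBasisRight_apply, h, map_zero, Finsupp.zero_apply]

/-- A linear retraction p of V onto D fixes t in each leg, because linear forms on the other leg
detect tensors. This criterion makes it easy to intersect and add subcoalgebras. -/
theorem mem_range_map_subtype_iff (D : Submodule k V) (t : V ⊗[k] V) :
    t ∈ LinearMap.range (TensorProduct.map D.subtype D.subtype) ↔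
      ∀ f : V →ₗ[k] k, TensorProduct.lid k V (f.rTensor V t) ∈ D ∧
        TensorProduct.rid k V (f.lTensor V t) ∈ D := by
  constructor
  · rintro ⟨s, rfl⟩ f
    induction s with
    | zero => simp
    | add x y hx hy =>
      simp only [map_add]
      exact ⟨add_mem hx.1 hy.1, add_mem hx.2 hy.2⟩
    | tmul x y =>
      simpa using ⟨D.smul_mem _ y.2, D.smul_mem _ x.2⟩
  · intro h
    obtain ⟨p, hp⟩ := LinearMap.exists_leftInverse_of_injective D.subtype D.ker_subtype
    have hp' (x : V) (hx : x ∈ D) : (p x : V) = x :=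
      congrArg Subtype.val (LinearMap.congr_fun hp ⟨x, hx⟩)
    have h1 : (D.subtype ∘ₗ p).lTensor V t = t := by
      rw [← sub_eq_zero]
      refine tensor_eq_zero_of_rTensor _ fun f => ?_
      rw [map_sub, map_sub, sub_eq_zero, ← LinearMap.comp_apply,
        LinearMap.rTensor_comp_lTensor, ← LinearMap.lTensor_comp_rTensor, LinearMap.comp_apply]
      have (s : k ⊗[k] V) : TensorProduct.lid k V ((D.subtype ∘ₗ p).lTensor k s) =
          p (TensorProduct.lid k V s) := by
        induction s with
        | zero => simp
        | add x y hx hy => simp only [map_add, hx, hy, Submodule.coe_add]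
        | tmul x y => simp
      rw [this, hp' _ (h f).1]
    have h2 : (D.subtype ∘ₗ p).rTensor V t = t := by
      rw [← sub_eq_zero]
      refine tensor_eq_zero_of_lTensor _ fun f => ?_
      rw [map_sub, map_sub, sub_eq_zero, ← LinearMap.comp_apply,
        LinearMap.lTensor_comp_rTensor, ← LinearMap.rTensor_comp_lTensor, LinearMap.comp_apply]
      have (s : V ⊗[k] k) : TensorProduct.rid k V ((D.subtype ∘ₗ p).rTensor k s) =
          p (TensorProduct.rid k V s) := by
        induction s with
        | zero => simp
        | add x y hx hy => simp only [map_add, hx, hy, Submodule.coe_add]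
        | tmul x y => simp
      rw [this, hp' _ (h f).2]
    refine ⟨TensorProduct.map p p t, ?_⟩
    rw [← LinearMap.comp_apply, ← TensorProduct.map_comp]
    conv_rhs => rw [← h2, ← h1]
    rw [← LinearMap.comp_apply (LinearMap.rTensor V _), LinearMap.rTensor_comp_lTensor]

end TensorSlices

section Coalgebra

variable {k C : Type*} [Field k] [AddCommGroup C] [Module k C] [Coalgebra k C]

theorem isSubcoalgebra_iff {D : Submodule k C} : IsSubcoalgebra D ↔
    ∀ x ∈ D, ∀ f : C →ₗ[k] k, TensorProduct.lid k C (f.rTensor C (comul x)) ∈ D ∧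
        TensorProduct.rid k C (f.lTensor C (comul x)) ∈ D :=
  forall₂_congr fun _ _ => mem_range_map_subtype_iff D _

theorem IsSubcoalgebra.inf {D E : Submodule k C} (hD : IsSubcoalgebra D) (hE : IsSubcoalgebra E) :
    IsSubcoalgebra (D ⊓ E) := by
  rw [isSubcoalgebra_iff] at *
  exact fun x hx f => ⟨⟨(hD x hx.1 f).1, (hE x hx.2 f).1⟩, ⟨(hD x hx.1 f).2, (hE x hx.2 f).2⟩⟩

theorem IsSubcoalgebra.sup {D E : Submodule k C} (hD : IsSubcoalgebra D) (hE : IsSubcoalgebra E) :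
    IsSubcoalgebra (D ⊔ E) := by
  rw [isSubcoalgebra_iff] at *
  intro x hx f
  obtain ⟨y, hy, z, hz, rfl⟩ := Submodule.mem_sup.mp hx
  simp only [map_add]
  exact ⟨Submodule.add_mem_sup (hD y hy f).1 (hE z hz f).1,
    Submodule.add_mem_sup (hD y hy f).2 (hE z hz f).2⟩

theorem isSubcoalgebra_bot : IsSubcoalgebra (⊥ : Submodule k C) := by
  intro x hx
  rw [(Submodule.mem_bot k).mp hx, map_zero]
  exact zero_mem _

end Coalgebra

variable {k B : Type*} [Field k] [Ring B] [HopfAlgebra k B]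

theorem isSubcoalgebra_span_one : IsSubcoalgebra (k ∙ (1 : B)) := by
  intro x hx
  obtain ⟨c, rfl⟩ := Submodule.mem_span_singleton.mp hx
  refine ⟨c • (⟨1, Submodule.mem_span_singleton_self 1⟩ ⊗ₜ
    ⟨1, Submodule.mem_span_singleton_self 1⟩), ?_⟩
  simp [Algebra.TensorProduct.one_def]

/-- In a cosemisimple Hopf algebra, the line spanned by `1` has a complementary subcoalgebra. -/
theorem IsCosemisimple.exists_isSubcoalgebra_compl [Module.Finite k B] (h : IsCosemisimple k B) :
    ∃ C : Submodule k B, IsSubcoalgebra C ∧ 1 ∉ C ∧ (k ∙ (1 : B)) ⊔ C = ⊤ := by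
  have : Nontrivial B := (Bialgebra.counitAlgHom k B).toRingHom.domain_nontrivial
  -- Take C maximal among the subcoalgebras avoiding 1. A simple D either lies in k1 + C or meets it
  -- trivially; in the latter case C + D still avoids 1, so D ≤ C by maximality.
  obtain ⟨C, ⟨hC, hC1⟩, hmax⟩ := WellFounded.has_min (wellFounded_gt (α := Submodule k B))
    {C | IsSubcoalgebra C ∧ 1 ∉ C}
    ⟨⊥, isSubcoalgebra_bot, fun h => one_ne_zero ((Submodule.mem_bot k).mp h)⟩
  refine ⟨C, hC, hC1, ?_⟩
  rw [IsCosemisimple] at h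
  rw [eq_top_iff, ← h, sSup_le_iff]
  rintro D ⟨hD, -, hD'⟩
  rcases hD' _ (hD.inf (isSubcoalgebra_span_one.sup hC)) inf_le_left with h0 | h0
  · by_cases h1 : (1 : B) ∈ C ⊔ D
    · obtain ⟨c, hc, x, hx, hcx⟩ := Submodule.mem_sup.mp h1
      refine absurd ?_ hC1
      have hx' : x ∈ D ⊓ ((k ∙ (1 : B)) ⊔ C) := by
        refine ⟨hx, ?_⟩
        rw [← eq_sub_iff_add_eq'] at hcx
        rw [hcx]
        exact sub_mem (Submodule.mem_sup_left (Submodule.mem_span_singleton_self 1))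
          (Submodule.mem_sup_right hc)
      rw [h0, Submodule.mem_bot] at hx'
      rwa [← hcx, hx', add_zero]
    · have hle : C ⊔ D ≤ C := by
        by_contra hlt
        exact hmax _ ⟨hC.sup hD, h1⟩ (lt_of_le_not_ge le_sup_left hlt)
      exact (le_sup_right.trans hle).trans le_sup_right
  · exact h0 ▸ inf_le_right

/-- The form that is 1 at 1 and zero on the complementary subcoalgebra C works: Δ(1) = 1 ⊗ 1, and
Δ(C) ⊆ C ⊗ C is killed by l in either leg. -/
theorem IsCosemisimple.exists_isTwoSidedCointegral [Module.Finite k B] (h : IsCosemisimple k B) :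
    ∃ l : B →ₗ[k] k, IsTwoSidedCointegral l ∧ l 1 = 1 := by
  obtain ⟨C, hC, hC1, hsup⟩ := h.exists_isSubcoalgebra_compl
  obtain ⟨f, hf1, hf⟩ := Submodule.exists_le_ker_of_notMem hC1
  set l : B →ₗ[k] k := (f 1)⁻¹ • f with hl
  have hl1 : l 1 = 1 := by simp [hl, hf1]
  have hlC (x : B) (hx : x ∈ C) : l x = 0 := by
    simp [hl, LinearMap.mem_ker.mp (hf hx)]
  have hlr : l ∘ₗ C.subtype = 0 := LinearMap.ext fun x => hlC x x.2
  refine ⟨l, ⟨fun b => ?_, fun b => ?_⟩, hl1⟩ <;>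
  · obtain ⟨_, hy, z, hz, rfl⟩ := Submodule.mem_sup.mp
      (hsup ▸ Submodule.mem_top : b ∈ (k ∙ (1 : B)) ⊔ C)
    obtain ⟨c, rfl⟩ := Submodule.mem_span_singleton.mp hy
    obtain ⟨s, hs⟩ := hC z hz
    have h0 : l.rTensor B (comul z) = 0 ∧ l.lTensor B (comul z) = 0 := by
      rw [← hs, ← LinearMap.comp_apply, ← LinearMap.comp_apply, LinearMap.rTensor_comp_map,
        LinearMap.lTensor_comp_map, hlr]
      simp
    simp [h0.1, h0.2, hlC z hz, hl1, Algebra.TensorProduct.one_def]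

end Cointegral

/-! ### Rigidity modulo a square-zero ideal. -/

section SquareZero

open Coalgebra

theorem smul_top_bilin_eq_zero {L M N P : Type*} [CommRing L] [AddCommGroup M] [Module L M]
    [AddCommGroup N] [Module L N] [AddCommGroup P] [Module L P] {I : Ideal L} (hI : I ^ 2 = ⊥)
    (β : M →ₗ[L] N →ₗ[L] P) {x : M} {y : N} (hx : x ∈ I • (⊤ : Submodule L M))
    (hy : y ∈ I • (⊤ : Submodule L N)) : β x y = 0 := by
  induction hx using Submodule.smul_induction_on' with
  | smul i hi m _ =>
    induction hy using Submodule.smul_induction_on' with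
    | smul j hj n _ =>
      have hij : i * j = 0 := by
        rw [← Ideal.mem_bot, ← hI, pow_two]
        exact Ideal.mul_mem_mul hi hj
      rw [map_smul, map_smul, LinearMap.smul_apply, smul_smul, mul_comm, hij, zero_smul]
    | add a _ b _ ha hb => rw [map_add, ha, hb, add_zero]
  | add a _ b _ ha hb => rw [map_add, LinearMap.add_apply, ha, hb, add_zero]

/-- For d = φ - ψ, the failure of the derivation rule is -d(a)d(b) and that of the coderivation rule
is -(d ⊗ d)Δ. Both vanish because I² = 0. -/
theorem BialgHom.eq_of_sub_mem_smul_top {L H K : Type*} [CommRing L] [Ring H] [Ring K]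
    [HopfAlgebra L H] [HopfAlgebra L K] [Module.Free L H] [Module.Finite L H] {φ ψ : H →ₐc[L] K}
    {l : K →ₗ[L] L} {Λ : H} {I : Ideal L} (hI : I ^ 2 = ⊥)
    (hS : ∀ a, φ (HopfAlgebra.antipode L a) = HopfAlgebra.antipode L (φ a))
    (hl : IsTwoSidedCointegral l) (hl1 : l 1 = 1)
    (hΛ : IsTwoSidedIntegral L Λ) (hΛ1 : counit (R := L) Λ = 1)
    (hsub : ∀ z, φ z - ψ z ∈ I • (⊤ : Submodule L K)) : φ = ψ := by
  obtain ⟨d, hd'⟩ : ∃ d : H →ₗ[L] K, d = (φ : H →ₗ[L] K) - (ψ : H →ₗ[L] K) := ⟨_, rfl⟩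
  have hd (z) : d z = φ z - ψ z := by rw [hd']; rfl
  simp only [← hd] at hsub
  have hd0 : d = 0 := by
    refine biderivation_eq_zero hS hl hl1 hΛ hΛ1 (fun a b => ?_) ?_
    · have h := smul_top_bilin_eq_zero hI (LinearMap.mul L K) (hsub a) (hsub b)
      rw [LinearMap.mul_apply', hd, hd] at h
      rw [hd, hd, hd, map_mul, map_mul, ← sub_eq_zero, ← neg_eq_zero, ← h]
      noncomm_ring
    · have h : TensorProduct.map d d = 0 := by
        refine TensorProduct.ext' fun a b => ?_
        rw [TensorProduct.map_tmul]
        exact smul_top_bilin_eq_zero hI (TensorProduct.mk L _ _) (hsub a) (hsub b)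
      have hφ : TensorProduct.map (φ : H →ₗ[L] K) (φ : H →ₗ[L] K) ∘ₗ comul =
        comul ∘ₗ (φ : H →ₗ[L] K) := φ.map_comp_comul
      have hψ : TensorProduct.map (ψ : H →ₗ[L] K) (ψ : H →ₗ[L] K) ∘ₗ comul =
        comul ∘ₗ (ψ : H →ₗ[L] K) := ψ.map_comp_comul
      have e : (φ : H →ₗ[L] K) = (ψ : H →ₗ[L] K) + d := by rw [hd', add_sub_cancel]
      rw [e] at hφ ⊢
      simp only [TensorProduct.map_add_left, TensorProduct.map_add_right, h, LinearMap.comp_add,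
        LinearMap.add_comp, hψ, add_zero, add_assoc, add_right_inj] at hφ ⊢
      rw [← hφ, add_comm]
  refine DFunLike.ext _ _ fun a => ?_
  rw [← sub_eq_zero, ← hd, hd0, LinearMap.zero_apply]

variable {k : Type u} [Field k] {L : Type t} [CommRing L] [Algebra k L]
variable {A : Type v} {B : Type w} [Ring A] [Ring B] [HopfAlgebra k A] [HopfAlgebra k B]

theorem mem_smul_top_of_scalarMap_eq_zero {I : Ideal L} {z : L ⊗[k] B}
    (hz : scalarMap B (Ideal.Quotient.mkₐ k I) z = 0) : z ∈ I • (⊤ : Submodule L (L ⊗[k] B)) := by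
  have hex : Function.Exact (I.subtype.restrictScalars k)
      (Ideal.Quotient.mkₐ k I).toLinearMap := by
    intro x
    rw [AlgHom.toLinearMap_apply, Ideal.Quotient.mkₐ_eq_mk, Ideal.Quotient.eq_zero_iff_mem]
    simp
  obtain ⟨y, rfl⟩ := (rTensor_exact B hex (Ideal.Quotient.mkₐ_surjective k I) z).mp hz
  clear hz
  induction y with
  | zero => simp
  | add y z hy hz => rw [map_add]; exact add_mem hy hz
  | tmul i b =>
    rw [LinearMap.rTensor_tmul, tmul_eq_smul]
    exact Submodule.smul_mem_smul i.2 Submodule.mem_top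

/-- Hopf maps between base changes of a semisimple and a cosemisimple Hopf algebra are determined
by their reductions modulo a square-zero ideal. -/
theorem HopfAlgHom.baseChange_mk_injective [Module.Finite k A] [Module.Finite k B]
    [IsSemisimpleRing A] (hB : IsCosemisimple k B) {I : Ideal L} (hI : I ^ 2 = ⊥) :
    Function.Injective fun φ : HopfAlgHom L (L ⊗[k] A) (L ⊗[k] B) =>
      φ.baseChange (Ideal.Quotient.mkₐ k I) := by
  intro φ ψ hφψ
  obtain ⟨Λ, hΛ, hΛ1⟩ := exists_isTwoSidedIntegral k A
  obtain ⟨l, hl, hl1⟩ := hB.exists_isTwoSidedCointegral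
  have h1 : formBaseChange L l 1 = 1 := by simp [Algebra.TensorProduct.one_def, hl1]
  have h2 : counit (R := L) ((1 : L) ⊗ₜ[k] Λ) = 1 := by simp [hΛ1]
  have h3 : ∀ z, φ.toBialgHom z - ψ.toBialgHom z ∈ I • (⊤ : Submodule L (L ⊗[k] B)) := by
    intro z
    refine mem_smul_top_of_scalarMap_eq_zero ?_
    have h := DFunLike.congr_fun (congrArg HopfAlgHom.toBialgHom hφψ)
      (scalarMap A (Ideal.Quotient.mkₐ k I) z)
    rw [map_sub, sub_eq_zero]
    have e1 := baseChangeAlgHom_scalarMap (Ideal.Quotient.mkₐ k I)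
      (φ.toBialgHom : L ⊗[k] A →ₐ[L] L ⊗[k] B) z
    have e2 := baseChangeAlgHom_scalarMap (Ideal.Quotient.mkₐ k I)
      (ψ.toBialgHom : L ⊗[k] A →ₐ[L] L ⊗[k] B) z
    exact e1.symm.trans (h.trans e2)
  have h4 : φ.toBialgHom = ψ.toBialgHom :=
    BialgHom.eq_of_sub_mem_smul_top hI φ.map_antipode hl.formBaseChange h1 hΛ.one_tmul h2 h3
  exact HopfAlgHom.toBialgHom_injective h4

end SquareZero

/-! ### Checking Hopf identities at points. -/

section Representability

open Coalgebra

variable {k : Type u} [Field k]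

theorem basis_repr_rTensor {L₁ L₂ V ι : Type*} [CommRing L₁] [CommRing L₂] [Algebra k L₁]
    [Algebra k L₂] [AddCommGroup V] [Module k V] (f : L₁ →ₐ[k] L₂) (b : Module.Basis ι k V)
    (z : L₁ ⊗[k] V) (i : ι) :
    (Algebra.TensorProduct.basis L₂ b).repr (f.toLinearMap.rTensor V z) i =
      f ((Algebra.TensorProduct.basis L₁ b).repr z i) := by
  induction z with
  | zero => simp
  | add y z hy hz => simp only [map_add, Finsupp.add_apply, hy, hz]
  | tmul x v => simp [Algebra.TensorProduct.basis_repr_tmul]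

variable {A : Type v} {B : Type w} [Ring A] [Ring B] [HopfAlgebra k A] [HopfAlgebra k B]

/-- The specialization of a linear map `A → Z ⊗ B` along `f : Z → L` is a Hopf map. -/
def IsHopfPoint {Z L : Type u} [CommRing Z] [Algebra k Z] [CommRing L] [Algebra k L]
    (g : A →ₗ[k] Z ⊗[k] B) (f : Z →ₐ[k] L) : Prop :=
  ∃ φ : HopfAlgHom L (L ⊗[k] A) (L ⊗[k] B), ∀ a, φ.toBialgHom (1 ⊗ₜ a) = scalarMap B f (g a)

variable {Z : Type u} [CommRing Z] [Algebra k Z] (g : A →ₗ[k] Z ⊗[k] B)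

/-- The points at which `g` specializes to a Hopf map separate the elements of `Z`. -/
def HasEnoughHopfPoints : Prop :=
  ∀ z : Z, (∀ (L : Type u) [CommRing L] [Algebra k L] (f : Z →ₐ[k] L), IsHopfPoint g f → f z = 0) →
    z = 0

variable {g}

/-- Z ⊗ V is free over Z, so separation of elements of Z passes to coordinates. Each Hopf axiom over
Z thus follows from its specializations. -/
theorem HasEnoughHopfPoints.rTensor (hg : HasEnoughHopfPoints g) {V : Type*} [AddCommGroup V]
    [Module k V] {z : Z ⊗[k] V} (hz : ∀ (L : Type u) [CommRing L] [Algebra k L] (f : Z →ₐ[k] L),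
      IsHopfPoint g f → f.toLinearMap.rTensor V z = 0) : z = 0 := by
  refine (Algebra.TensorProduct.basis Z (Module.Free.chooseBasis k V)).repr.injective
    (Finsupp.ext fun i => ?_)
  rw [map_zero, Finsupp.zero_apply]
  refine hg _ fun L _ _ f hf => ?_
  rw [← basis_repr_rTensor, hz L f hf, map_zero, Finsupp.zero_apply]

theorem HasEnoughHopfPoints.eq_of_scalarMap (hg : HasEnoughHopfPoints g) {z z' : Z ⊗[k] B}
    (h : ∀ (L : Type u) [CommRing L] [Algebra k L] (f : Z →ₐ[k] L),
      IsHopfPoint g f → scalarMap B f z = scalarMap B f z') : z = z' := by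
  rw [← sub_eq_zero]
  refine hg.rTensor fun L _ _ f hf => ?_
  change scalarMap B f (z - z') = 0
  rw [map_sub, h L f hf, sub_self]

theorem scalarMap₂_distribBaseChange {L : Type u} [CommRing L] [Algebra k L] (f : Z →ₐ[k] L)
    (z : Z ⊗[k] (B ⊗[k] B)) :
    scalarMap₂ B f (TensorProduct.AlgebraTensorModule.distribBaseChange k Z B B z) =
      TensorProduct.AlgebraTensorModule.distribBaseChange k L B B (f.toLinearMap.rTensor _ z) := by
  induction z with
  | zero => simp
  | add y z hy hz => simp only [map_add, hy, hz]
  | tmul x v =>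
    induction v with
    | zero => simp
    | add y z hy hz => simp only [TensorProduct.tmul_add, map_add, hy, hz]
    | tmul y z => simp

theorem HasEnoughHopfPoints.eq_of_scalarMap₂ (hg : HasEnoughHopfPoints g)
    {z z' : (Z ⊗[k] B) ⊗[Z] (Z ⊗[k] B)}
    (h : ∀ (L : Type u) [CommRing L] [Algebra k L] (f : Z →ₐ[k] L),
      IsHopfPoint g f → scalarMap₂ B f z = scalarMap₂ B f z') : z = z' := by
  let e := TensorProduct.AlgebraTensorModule.distribBaseChange k Z B B
  rw [← sub_eq_zero, ← e.symm.map_eq_zero_iff]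
  refine hg.rTensor fun L _ _ f hf => ?_
  rw [← (TensorProduct.AlgebraTensorModule.distribBaseChange k L B B).map_eq_zero_iff,
    ← scalarMap₂_distribBaseChange]
  change scalarMap₂ B f (e (e.symm (z - z'))) = 0
  rw [e.apply_symm_apply, map_sub, h L f hf, sub_self]

theorem scalarMap_liftBaseChange {L : Type u} [CommRing L] [Algebra k L] {f : Z →ₐ[k] L}
    {φ : HopfAlgHom L (L ⊗[k] A) (L ⊗[k] B)}
    (hφ : ∀ a, φ.toBialgHom (1 ⊗ₜ a) = scalarMap B f (g a)) (z : Z ⊗[k] A) :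
    scalarMap B f (g.liftBaseChange Z z) = φ.toBialgHom (scalarMap A f z) := by
  induction z with
  | zero => simp
  | add y z hy hz => simp only [map_add, hy, hz]
  | tmul x a =>
    rw [LinearMap.liftBaseChange_tmul, scalarMap_smul, ← hφ, ← map_smul, scalarMap_tmul,
      ← tmul_eq_smul]

theorem scalarMap₂_map_liftBaseChange {L : Type u} [CommRing L] [Algebra k L] {f : Z →ₐ[k] L}
    {φ : HopfAlgHom L (L ⊗[k] A) (L ⊗[k] B)}
    (hφ : ∀ a, φ.toBialgHom (1 ⊗ₜ a) = scalarMap B f (g a)) (z : (Z ⊗[k] A) ⊗[Z] (Z ⊗[k] A)) :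
    scalarMap₂ B f (TensorProduct.map (g.liftBaseChange Z) (g.liftBaseChange Z) z) =
      TensorProduct.map φ.toBialgHom.toLinearMap φ.toBialgHom.toLinearMap (scalarMap₂ A f z) := by
  induction z with
  | zero => simp
  | add y z hy hz => simp only [map_add, hy, hz]
  | tmul x y =>
    simp only [TensorProduct.map_tmul, scalarMap₂_tmul, scalarMap_liftBaseChange hφ]
    rfl

/-- A linear map `A → Z ⊗ B` with enough Hopf points extends to a Hopf map over `Z`. -/
theorem HasEnoughHopfPoints.exists_hopfAlgHom (hg : HasEnoughHopfPoints g) :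
    ∃ φ : HopfAlgHom Z (Z ⊗[k] A) (Z ⊗[k] B), ∀ a, φ.toBialgHom (1 ⊗ₜ a) = g a := by
  have h1 : g.liftBaseChange Z 1 = 1 := hg.eq_of_scalarMap fun L _ _ f ⟨φ, hφ⟩ => by
    rw [scalarMap_liftBaseChange hφ, map_one, map_one, map_one]
  have hmul (x y) : g.liftBaseChange Z (x * y) = g.liftBaseChange Z x * g.liftBaseChange Z y :=
    hg.eq_of_scalarMap fun L _ _ f ⟨φ, hφ⟩ => by
      rw [scalarMap_liftBaseChange hφ, map_mul, map_mul, map_mul, scalarMap_liftBaseChange hφ,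
        scalarMap_liftBaseChange hφ]
  have hcounit (x) : counit (R := Z) (g.liftBaseChange Z x) = counit (R := Z) x := by
    rw [← sub_eq_zero]
    refine hg _ fun L _ _ f ⟨φ, hφ⟩ => ?_
    rw [map_sub, ← counit_scalarMap, ← counit_scalarMap, scalarMap_liftBaseChange hφ,
      CoalgHomClass.counit_comp_apply, sub_self]
  have hcomul (x) : TensorProduct.map (g.liftBaseChange Z) (g.liftBaseChange Z)
      (comul (R := Z) x) = comul (R := Z) (g.liftBaseChange Z x) :=
    hg.eq_of_scalarMap₂ fun L _ _ f ⟨φ, hφ⟩ => by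
      rw [scalarMap₂_map_liftBaseChange hφ, ← comul_scalarMap, ← comul_scalarMap,
        scalarMap_liftBaseChange hφ]
      exact CoalgHomClass.map_comp_comul_apply φ.toBialgHom _
  have hantipode (x) : g.liftBaseChange Z (HopfAlgebra.antipode Z x) =
      HopfAlgebra.antipode Z (g.liftBaseChange Z x) :=
    hg.eq_of_scalarMap fun L _ _ f ⟨φ, hφ⟩ => by
      rw [← antipode_scalarMap, scalarMap_liftBaseChange hφ, scalarMap_liftBaseChange hφ,
        ← antipode_scalarMap]
      exact φ.map_antipode _
  exact ⟨{ toBialgHom := BialgHom.ofAlgHom (AlgHom.ofLinearMap (g.liftBaseChange Z) h1 hmul)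
            (AlgHom.ext hcounit) (AlgHom.ext hcomul)
           map_antipode := hantipode }, fun a => by
    change g.liftBaseChange Z (1 ⊗ₜ a) = g a
    rw [LinearMap.liftBaseChange_tmul, one_smul]⟩

end Representability

/-! ### The universal Hopf map in coordinates. -/

section Representability

variable {k : Type u} [Field k]

section LinearMapOfCoord

variable {V W ι κ : Type*} [AddCommGroup V] [Module k V] [AddCommGroup W] [Module k W]
  [Fintype κ] {L : Type*} [CommRing L] [Algebra k L]

/-- The linear map `V → L ⊗ W` with the given coordinates. -/
noncomputable def linearMapOfCoord (eV : Module.Basis ι k V) (eW : Module.Basis κ k W)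
    (x : ι × κ → L) : V →ₗ[k] L ⊗[k] W :=
  eV.constr k fun i => ∑ j, x (i, j) • Algebra.TensorProduct.basis L eW j

theorem linearMapOfCoord_basis (eV : Module.Basis ι k V) (eW : Module.Basis κ k W)
    (x : ι × κ → L) (i : ι) : linearMapOfCoord eV eW x (eV i) =
      ∑ j, x (i, j) • Algebra.TensorProduct.basis L eW j :=
  eV.constr_basis k _ i

theorem repr_linearMapOfCoord (eV : Module.Basis ι k V) (eW : Module.Basis κ k W)
    (x : ι × κ → L) (i : ι) (j : κ) :
    (Algebra.TensorProduct.basis L eW).repr (linearMapOfCoord eV eW x (eV i)) j = x (i, j) := by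
  rw [linearMapOfCoord_basis, Module.Basis.repr_sum_self]

theorem linearMapOfCoord_repr (eV : Module.Basis ι k V) (eW : Module.Basis κ k W)
    (g : V →ₗ[k] L ⊗[k] W) :
    linearMapOfCoord eV eW
      (fun p => (Algebra.TensorProduct.basis L eW).repr (g (eV p.1)) p.2) = g :=
  eV.ext fun i => by
    rw [linearMapOfCoord_basis]
    exact Module.Basis.sum_repr (Algebra.TensorProduct.basis L eW) (g (eV i))

end LinearMapOfCoord

variable {A : Type v} {B : Type w} [Ring A] [Ring B] [HopfAlgebra k A] [HopfAlgebra k B]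
  {ι κ : Type*} [Fintype κ]

theorem scalarMap_linearMapOfCoord {L₁ L₂ : Type t} [CommRing L₁] [CommRing L₂] [Algebra k L₁]
    [Algebra k L₂] (eA : Module.Basis ι k A) (eB : Module.Basis κ k B) (f : L₁ →ₐ[k] L₂)
    (x : ι × κ → L₁) (a : A) :
    scalarMap B f (linearMapOfCoord eA eB x a) = linearMapOfCoord eA eB (f ∘ x) a := by
  have : (scalarMap B f).toLinearMap ∘ₗ linearMapOfCoord eA eB x =
      linearMapOfCoord eA eB (f ∘ x) := by
    refine eA.ext fun i => ?_
    rw [LinearMap.comp_apply, linearMapOfCoord_basis, linearMapOfCoord_basis, map_sum]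
    exact Finset.sum_congr rfl fun j _ => by simp [scalarMap_smul]
  exact LinearMap.congr_fun this a

/-- The polynomials in the matrix entries of a linear map `A → L ⊗ B` that vanish whenever the
linear map comes from a Hopf map. -/
noncomputable def hopfIdeal {n m : ℕ} (eA : Module.Basis (Fin n) k A)
    (eB : Module.Basis (Fin m) k B) : Ideal (MvPolynomial (Fin n × Fin m) k) where
  carrier := {p | ∀ (L : Type u) [CommRing L] [Algebra k L]
    (f : MvPolynomial (Fin n × Fin m) k →ₐ[k] L),
    IsHopfPoint (linearMapOfCoord eA eB MvPolynomial.X) f → f p = 0}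
  zero_mem' := fun L _ _ f _ => map_zero f
  add_mem' := fun {p q} hp hq L _ _ f hf => by rw [map_add, hp L f hf, hq L f hf, add_zero]
  smul_mem' := fun c p hp L _ _ f hf => by rw [smul_eq_mul, map_mul, hp L f hf, mul_zero]

variable (k A B) in
theorem exists_universal_hopfAlgHom [Module.Finite k A] [Module.Finite k B] :
    ∃ (Z : Type u) (_ : CommRing Z) (_ : Algebra k Z) (Φ : HopfAlgHom Z (Z ⊗[k] A) (Z ⊗[k] B)),
      Algebra.FiniteType k Z ∧ ∀ (L : Type u) [CommRing L] [Algebra k L],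
        Function.Bijective fun h : Z →ₐ[k] L => Φ.baseChange h := by
  let eA := Module.finBasis k A
  let eB := Module.finBasis k B
  let P := MvPolynomial (Fin (Module.finrank k A) × Fin (Module.finrank k B)) k
  let I : Ideal P := hopfIdeal eA eB
  let π : P →ₐ[k] P ⧸ I := Ideal.Quotient.mkₐ k I
  -- Every Hopf point of the polynomial ring kills I by definition, so it factors through the
  -- quotient; a class vanishing at all of them is therefore zero.
  have hg : HasEnoughHopfPoints (linearMapOfCoord eA eB (π ∘ MvPolynomial.X)) := by
    intro z hz
    obtain ⟨p, rfl⟩ := Ideal.Quotient.mkₐ_surjective k I z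
    refine Ideal.Quotient.eq_zero_iff_mem.mpr fun L _ _ f hf => ?_
    refine hz L (Ideal.Quotient.liftₐ I f fun q hq => hq L f hf) ?_
    obtain ⟨φ, hφ⟩ := hf
    refine ⟨φ, fun a => ?_⟩
    rw [hφ, scalarMap_linearMapOfCoord, scalarMap_linearMapOfCoord]
    rfl
  obtain ⟨Φ, hΦ⟩ := hg.exists_hopfAlgHom
  have hb (L : Type u) [CommRing L] [Algebra k L] (h : P ⧸ I →ₐ[k] L) (a : A) :
      (Φ.baseChange h).toBialgHom (1 ⊗ₜ a) =
        linearMapOfCoord eA eB (h ∘ π ∘ MvPolynomial.X) a := by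
    rw [HopfAlgHom.baseChange_tmul, one_smul, hΦ, scalarMap_linearMapOfCoord]
  refine ⟨P ⧸ I, inferInstance, inferInstance, Φ, inferInstance, fun L _ _ => ⟨?_, ?_⟩⟩
  · intro h₁ h₂ h
    refine Ideal.Quotient.algHom_ext k (MvPolynomial.algHom_ext fun p => ?_)
    have e : linearMapOfCoord eA eB (h₁ ∘ π ∘ MvPolynomial.X) (eA p.1) =
        linearMapOfCoord eA eB (h₂ ∘ π ∘ MvPolynomial.X) (eA p.1) := by
      rw [← hb, ← hb]
      exact DFunLike.congr_fun (congrArg HopfAlgHom.toBialgHom h) _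
    have := DFunLike.congr_fun (congrArg (Algebra.TensorProduct.basis L eB).repr e) p.2
    rwa [repr_linearMapOfCoord, repr_linearMapOfCoord] at this
  · intro φ
    let g : A →ₗ[k] L ⊗[k] B :=
      (φ.toBialgHom : L ⊗[k] A →ₗ[L] L ⊗[k] B).restrictScalars k ∘ₗ TensorProduct.mk k L A 1
    let x := fun p : Fin (Module.finrank k A) × Fin (Module.finrank k B) =>
      (Algebra.TensorProduct.basis L eB).repr (g (eA p.1)) p.2
    have hx : linearMapOfCoord eA eB x = g := linearMapOfCoord_repr eA eB g
    have hX : (MvPolynomial.aeval x : P →ₐ[k] L) ∘ MvPolynomial.X = x :=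
      funext fun p => MvPolynomial.aeval_X x p
    have hf : IsHopfPoint (linearMapOfCoord eA eB MvPolynomial.X)
        (MvPolynomial.aeval x : P →ₐ[k] L) := ⟨φ, fun a => by
      rw [scalarMap_linearMapOfCoord, hX, hx]
      rfl⟩
    refine ⟨Ideal.Quotient.liftₐ I (MvPolynomial.aeval x) fun q hq => hq L _ hf, ?_⟩
    refine HopfAlgHom.ext_tmul fun a => ?_
    rw [hb]
    change linearMapOfCoord eA eB ((MvPolynomial.aeval x : P →ₐ[k] L) ∘ MvPolynomial.X) a = g a
    rw [hX, hx]

open CategoryTheory in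
/-- A universal Hopf map corepresents the functor of Hopf maps. -/
noncomputable def corepresentableByOfUniversal {Z : Type u} [CommRing Z] [Algebra k Z]
    (Φ : HopfAlgHom Z (Z ⊗[k] A) (Z ⊗[k] B))
    (hΦ : ∀ (L : Type u) [CommRing L] [Algebra k L],
      Function.Bijective fun h : Z →ₐ[k] L => Φ.baseChange h) :
    (hopfFunctor k A B).CorepresentableBy (CommAlgCat.of k Z) where
  homEquiv {L} := Equiv.ofBijective
    (fun h : CommAlgCat.of k Z ⟶ L => (Φ.baseChange h.hom : HopfAlgHom L (L ⊗[k] A) (L ⊗[k] B)))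
    ⟨fun _ _ h => CommAlgCat.hom_ext ((hΦ L).1 h), fun φ =>
      let ⟨h, hh⟩ := (hΦ L).2 φ
      ⟨CommAlgCat.ofHom h, hh⟩⟩
  homEquiv_comp {L L'} g f := by
    have h : (Φ.baseChange (g.hom.comp f.hom) : HopfAlgHom L' (L' ⊗[k] A) (L' ⊗[k] B)) =
      (Φ.baseChange f.hom).baseChange g.hom := Φ.baseChange_comp f.hom g.hom
    exact h

end Representability

/-! ### From rigidity to finite étale. -/

section Etale

variable {k : Type u} [Field k] {A : Type v} {B : Type w} [Ring A] [Ring B] [HopfAlgebra k A]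
  [HopfAlgebra k B]

open CategoryTheory in
-- Under the representing bijection, uniqueness of lifts Z → L along L → L/I is exactly injectivity
-- of reduction of Hopf maps modulo I.
theorem formallyUnramified_of_corepresentableBy [Module.Finite k A] [Module.Finite k B]
    [IsSemisimpleRing A] (hB : IsCosemisimple k B) {Z : CommAlgCat.{u} k}
    (e : (hopfFunctor k A B).CorepresentableBy Z) : Algebra.FormallyUnramified k Z := by
  refine Algebra.FormallyUnramified.iff_comp_injective.mpr fun L _ _ I hI f₁ f₂ h => ?_
  have key (f : Z →ₐ[k] L) : e.homEquiv (CommAlgCat.ofHom ((Ideal.Quotient.mkₐ k I).comp f)) =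
      HopfAlgHom.baseChange (Ideal.Quotient.mkₐ k I)
        (e.homEquiv (CommAlgCat.ofHom f) : HopfAlgHom L (L ⊗[k] A) (L ⊗[k] B)) :=
    e.homEquiv_comp (CommAlgCat.ofHom (Ideal.Quotient.mkₐ k I)) (CommAlgCat.ofHom f)
  have h' := (key f₁).symm.trans ((congrArg (fun g => e.homEquiv (CommAlgCat.ofHom g)) h).trans
    (key f₂))
  have h'' := e.homEquiv.injective (HopfAlgHom.baseChange_mk_injective hB hI h')
  exact congrArg (fun g => g.hom) h''

open CategoryTheory in
theorem finiteType_of_corepresentableBy [Module.Finite k A] [Module.Finite k B]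
    {Z : CommAlgCat.{u} k} (e : (hopfFunctor k A B).CorepresentableBy Z) :
    Algebra.FiniteType k Z := by
  obtain ⟨Z', _, _, Φ, hfin, hΦ⟩ := exists_universal_hopfAlgHom k A B
  exact hfin.equiv
    (CommAlgCat.algEquivOfIso ((corepresentableByOfUniversal Φ hΦ).uniqueUpToIso e))

/-- Both hypotheses pass to E ⊗ Z, which is then finite over E and reduced, and a reduced
commutative Artinian ring is semisimple. -/
theorem isSeparableAlgebra_of_formallyUnramified (Z : Type v) [CommRing Z] [Algebra k Z]
    [Algebra.FiniteType k Z] [Algebra.FormallyUnramified k Z] : IsSeparableAlgebra k Z := by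
  intro E _ _
  have : Module.Finite E (E ⊗[k] Z) := Algebra.FormallyUnramified.finite_of_free _ _
  have : IsArtinianRing (E ⊗[k] Z) := IsArtinianRing.of_finite E _
  have : IsReduced (E ⊗[k] Z) := Algebra.FormallyUnramified.isReduced_of_field E _
  exact IsArtinianRing.isSemisimpleRing_of_isReduced _

end Etale

end HopfScheme

theorem proposition3p9 {k : Type u} [Field k] {A : Type v} {B : Type w} [Ring A] [Ring B]
    [HopfAlgebra k A] [HopfAlgebra k B] [Module.Finite k A] [Module.Finite k B]
    (hA : IsSemisimpleRing A) (hB : HopfScheme.IsCosemisimple k B) :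
    (∃ Z : CommAlgCat.{u} k,
      Nonempty ((HopfScheme.hopfFunctor k A B).CorepresentableBy Z)) ∧
    ∀ Z : CommAlgCat.{u} k, (HopfScheme.hopfFunctor k A B).CorepresentableBy Z →
      Module.Finite k Z ∧ HopfScheme.IsSeparableAlgebra k Z ∧ Algebra.Etale k Z := by
  constructor
  · obtain ⟨Z, _, _, Φ, -, hΦ⟩ := HopfScheme.exists_universal_hopfAlgHom k A B
    exact ⟨_, ⟨HopfScheme.corepresentableByOfUniversal Φ hΦ⟩⟩
  · intro Z e
    have := HopfScheme.formallyUnramified_of_corepresentableBy hB e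
    have := HopfScheme.finiteType_of_corepresentableBy e
    have : Algebra.FormallyEtale k Z := Algebra.FormallyEtale.of_formallyUnramified_of_field k Z
    have : Algebra.FinitePresentation k Z :=
      Algebra.FinitePresentation.of_finiteType.mp inferInstance
    exact ⟨Algebra.FormallyUnramified.finite_of_free k Z,
      HopfScheme.isSeparableAlgebra_of_formallyUnramified Z, ⟨inferInstance, inferInstance⟩⟩
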